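/- Let $A\in\mathbb R^{n\times n}$, $B\in\mathbb R^{n\times b}$, $C\in\mathbb R^{c\times n}$. Assume that $(A,B)$ is stabilizable and $(A,C)$ is detectable, i.e. there are real matrices $K,L$ such that all eigenvalues of $A-BK$ and of $A-LC$ have negative real part. Write $\mathcal R(X)=A^TX+XA-XBB^TX+C^TC$. Then: (a) The algebraic Riccati equation $\mathcal R(X)=0$ has a unique symmetric positive semidefinite solution $X_\infty\in\mathbb R^{n\times n}$, and the differential Riccati equation $\dot X(t)=\mathcal R(X(t))$, $X(0)=0$, has a unique solution $X:[0,\infty)\to\mathbb R^{n\times n}$. (b) Let $\lambda_1(X_\infty)\ge\dots\ge\lambda_n(X_\infty)$ be the eigenvalues of $X_\infty$ (with multiplicity) and let $q_1,\dots,q_n\in\mathbb R^n$ be orthonormal eigenvectors with $X_\infty q_i=\lambda_i(X_\infty)q_i$. Then for all $i,j\in\{1,\dots,n\}$ and all $t\ge 0$ $$|q_i^TX(t)q_j|\le\sqrt{\lambda_i(X_\infty)\,\lambda_j(X_\infty)}.$$ (c) For $0\le k\le n$ put $Q_k=[q_1,\dots,q_k]\in\mathbb R^{n\times k}$, $\mathcal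 Q_k=\{Q_kYQ_k^T : Y\in\mathbb R^{k\times k}\}$ and $\mathcal P_k(M)=Q_kQ_k^TMQ_kQ_k^T$. Then for all $t\ge 0$ the matrix $\mathcal P_k(X(t))\in\mathcal Q_k$ is a best approximation of $X(t)$ in $\mathcal Q_k$ in the Frobenius norm, that is, $\|X(t)-\mathcal P_k(X(t))\|_F\le\|X(t)-Z\|_F$ for all $Z\in\mathcal Q_k$, and $$\|X(t)-\mathcal P_k(X(t))\|_F\le\Bigl(\sum_{\substack{1\le i,j\le n\\ i>k\ \text{or}\ j>k}}\lambda_i(X_\infty)\,\lambda_j(X_\infty)\Bigr)^{1/2}.$$ -/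

import Mathlib

open scoped Matrix

/-- A real square matrix is stable if its complex spectrum lies in the open left half plane. -/
def IsStableMatrix {n : ℕ} (M : Matrix (Fin n) (Fin n) ℝ) : Prop :=
  ∀ z ∈ spectrum ℂ (M.map (algebraMap ℝ ℂ)), z.re < 0

/-- `(A, B)` is stabilizable: some state feedback `K` makes `A - B K` stable. -/
def IsStabilizable {n b : ℕ} (A : Matrix (Fin n) (Fin n) ℝ) (B : Matrix (Fin n) (Fin b) ℝ) :
    Prop :=
  ∃ K : Matrix (Fin b) (Fin n) ℝ, IsStableMatrix (A - B * K)

/-- `(A, C)` is detectable: some output injection `L` makes `A - L C` stable. -/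
def IsDetectable {n c : ℕ} (A : Matrix (Fin n) (Fin n) ℝ) (C : Matrix (Fin c) (Fin n) ℝ) :
    Prop :=
  ∃ L : Matrix (Fin n) (Fin c) ℝ, IsStableMatrix (A - L * C)

/-- The Riccati operator `R(X) = Aᵀ X + X A - X B Bᵀ X + Cᵀ C`. -/
def riccati {n b c : ℕ} (A : Matrix (Fin n) (Fin n) ℝ) (B : Matrix (Fin n) (Fin b) ℝ)
    (C : Matrix (Fin c) (Fin n) ℝ) (X : Matrix (Fin n) (Fin n) ℝ) : Matrix (Fin n) (Fin n) ℝ :=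
  Aᵀ * X + X * A - X * B * Bᵀ * X + Cᵀ * C

/-- `X` is a symmetric positive semidefinite solution of the algebraic Riccati equation. -/
def IsPSDSolutionARE {n b c : ℕ} (A : Matrix (Fin n) (Fin n) ℝ) (B : Matrix (Fin n) (Fin b) ℝ)
    (C : Matrix (Fin c) (Fin n) ℝ) (X : Matrix (Fin n) (Fin n) ℝ) : Prop :=
  X.PosSemidef ∧ riccati A B C X = 0

/-- `X` solves the differential Riccati equation on `[0, ∞)` with initial value `X₀`
(the derivative at `0` is the right derivative). Values of `X` at negative times are irrelevant. -/
def IsSolutionDRE {n b c : ℕ} (A : Matrix (Fin n) (Fin n) ℝ) (B : Matrix (Fin n) (Fin b) ℝ)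
    (C : Matrix (Fin c) (Fin n) ℝ) (X₀ : Matrix (Fin n) (Fin n) ℝ)
    (X : ℝ → Matrix (Fin n) (Fin n) ℝ) : Prop :=
  X 0 = X₀ ∧ ∀ t : ℝ, 0 ≤ t → HasDerivWithinAt X (riccati A B C (X t)) (Set.Ici 0) t

/-- The eigenvalues of a symmetric matrix, with multiplicity, in non-increasing order;
index `i : Fin n` stands for the `(i + 1)`-st largest one. -/
noncomputable def eigenvalueDesc {n : ℕ} {S : Matrix (Fin n) (Fin n) ℝ} (hS : S.IsHermitian)
    (i : Fin n) : ℝ :=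
  hS.eigenvalues₀ (Fin.cast (Fintype.card_fin n).symm i)

/-- The matrix whose columns are the first `k` of the vectors `q`. -/
def leadingColumns {n : ℕ} (q : Fin n → EuclideanSpace ℝ (Fin n)) (k : ℕ) (hk : k ≤ n) :
    Matrix (Fin n) (Fin k) ℝ :=
  Matrix.of fun a l => q (Fin.castLE hk l) a

/-- The Galerkin trial space `{Q Y Qᵀ}` belonging to a matrix `Q` of basis vectors. -/
def galerkinSpace {n k : ℕ} (Q : Matrix (Fin n) (Fin k) ℝ) : Set (Matrix (Fin n) (Fin n) ℝ) :=
  {Z | ∃ Y : Matrix (Fin k) (Fin k) ℝ, Z = Q * Y * Qᵀ}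

/-- The projection `M ↦ Q Qᵀ M Q Qᵀ` onto the Galerkin trial space. -/
def galerkinProj {n k : ℕ} (Q : Matrix (Fin n) (Fin k) ℝ) (M : Matrix (Fin n) (Fin n) ℝ) :
    Matrix (Fin n) (Fin n) ℝ :=
  Q * Qᵀ * M * Q * Qᵀ

section

attribute [local instance] Matrix.frobeniusSeminormedAddCommGroup

/-- The Frobenius norm. -/
noncomputable def frobeniusNorm {n : ℕ} (M : Matrix (Fin n) (Fin n) ℝ) : ℝ := ‖M‖

end

/-! ### Differentiation of matrix curves, entry by entry -/

section MatrixCalculus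

variable {l m n : ℕ} {s : Set ℝ} {t : ℝ}

/-! The bounds rest on 0 ≤ X(t) ≤ X∞ in the Loewner order. Given this, Cauchy–Schwarz for the form
X(t) bounds (qᵢᵀ X(t) qⱼ)² by the product of the diagonal values, which are at most λᵢ and λⱼ. In
the coordinates of q, the Galerkin projection keeps the leading k × k block and zeroes the rest, so
(c) is an entrywise comparison.

The differential equation is linearized: X = V U⁻¹ for the Hamiltonian flow (U, V) from (1, 0).
Monotonicity of UᵀV gives invertibility of U (`isUnit_fst`) and X ≥ 0; conservation of the
Hamiltonian form gives R(X) ≥ 0, so X increases. `le_of_supersolution` gives X ≤ P whenever P ≥ 0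
and R(P) ≤ 0.

Stabilizability supplies such a P through a Lyapunov equation, so X(t) converges, and its limit
solves R = 0. Uniqueness uses detectability: every positive semidefinite solution has a stable
closed loop, and the difference of two solutions then satisfies a homogeneous Sylvester equation
with only the zero solution. Stability enters through the Cayley transform, which turns it into
geometric decay of matrix powers. -/

theorem hasDerivWithinAt_matrix {M : ℝ → Matrix (Fin m) (Fin n) ℝ} {M' : Matrix (Fin m) (Fin n) ℝ} :
    HasDerivWithinAt M M' s t ↔
      ∀ i j, HasDerivWithinAt (fun x => M x i j) (M' i j) s t := by
  have h1 : HasDerivWithinAt M M' s t ↔ ∀ i, HasDerivWithinAt (fun x => M x i) (M' i) s t :=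
    hasDerivWithinAt_pi (E' := fun _ : Fin m => Fin n → ℝ)
  rw [h1]
  exact forall_congr' fun i => hasDerivWithinAt_pi (E' := fun _ : Fin n => ℝ)

theorem HasDerivWithinAt.matrix_mul {M : ℝ → Matrix (Fin l) (Fin m) ℝ}
    {N : ℝ → Matrix (Fin m) (Fin n) ℝ} {M' : Matrix (Fin l) (Fin m) ℝ}
    {N' : Matrix (Fin m) (Fin n) ℝ} (hM : HasDerivWithinAt M M' s t)
    (hN : HasDerivWithinAt N N' s t) :
    HasDerivWithinAt (fun x => M x * N x) (M' * N t + M t * N') s t := by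
  rw [hasDerivWithinAt_matrix] at *
  intro i j
  simp only [Matrix.mul_apply, Matrix.add_apply, ← Finset.sum_add_distrib]
  exact HasDerivWithinAt.fun_sum fun k _ => (hM i k).mul (hN k j)

theorem HasDerivWithinAt.matrix_transpose {M : ℝ → Matrix (Fin m) (Fin n) ℝ}
    {M' : Matrix (Fin m) (Fin n) ℝ} (hM : HasDerivWithinAt M M' s t) :
    HasDerivWithinAt (fun x => (M x)ᵀ) M'ᵀ s t := by
  rw [hasDerivWithinAt_matrix] at *
  exact fun i j => hM j i

theorem HasDerivWithinAt.matrix_add {M N : ℝ → Matrix (Fin m) (Fin n) ℝ}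
    {M' N' : Matrix (Fin m) (Fin n) ℝ} (hM : HasDerivWithinAt M M' s t)
    (hN : HasDerivWithinAt N N' s t) :
    HasDerivWithinAt (fun x => M x + N x) (M' + N') s t := by
  rw [hasDerivWithinAt_matrix] at *
  exact fun i j => (hM i j).add (hN i j)

theorem HasDerivWithinAt.matrix_sub {M N : ℝ → Matrix (Fin m) (Fin n) ℝ}
    {M' N' : Matrix (Fin m) (Fin n) ℝ} (hM : HasDerivWithinAt M M' s t)
    (hN : HasDerivWithinAt N N' s t) :
    HasDerivWithinAt (fun x => M x - N x) (M' - N') s t := by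
  rw [hasDerivWithinAt_matrix] at *
  exact fun i j => (hM i j).sub (hN i j)

theorem hasDerivWithinAt_matrix_const (M : Matrix (Fin m) (Fin n) ℝ) :
    HasDerivWithinAt (fun _ => M) 0 s t := by
  rw [hasDerivWithinAt_matrix]
  exact fun i j => hasDerivWithinAt_const _ _ _

theorem HasDerivWithinAt.matrix_mul_const {M : ℝ → Matrix (Fin l) (Fin m) ℝ}
    {M' : Matrix (Fin l) (Fin m) ℝ} (hM : HasDerivWithinAt M M' s t)
    (N : Matrix (Fin m) (Fin n) ℝ) :
    HasDerivWithinAt (fun x => M x * N) (M' * N) s t := by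
  simpa using hM.matrix_mul (hasDerivWithinAt_matrix_const N)

theorem HasDerivWithinAt.matrix_bilin {M : ℝ → Matrix (Fin m) (Fin n) ℝ}
    {M' : Matrix (Fin m) (Fin n) ℝ} (hM : HasDerivWithinAt M M' s t)
    (y : Fin m → ℝ) (z : Fin n → ℝ) :
    HasDerivWithinAt (fun x => y ⬝ᵥ (M x *ᵥ z)) (y ⬝ᵥ (M' *ᵥ z)) s t := by
  rw [hasDerivWithinAt_matrix] at hM
  simp only [dotProduct, Matrix.mulVec]
  exact HasDerivWithinAt.fun_sum fun i _ =>
    (HasDerivWithinAt.fun_sum fun j _ => (hM i j).mul_const (z j)).const_mul (y i)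

theorem Matrix.eq_of_hasDerivWithinAt_zero {M : ℝ → Matrix (Fin m) (Fin n) ℝ}
    (hM : ∀ x, 0 ≤ x → HasDerivWithinAt M 0 (Set.Ici 0) x) {t : ℝ} (ht : 0 ≤ t) :
    M t = M 0 := by
  ext i j
  have h := fun x hx => (hasDerivWithinAt_matrix.1 (hM x hx)) i j
  refine constant_of_has_deriv_right_zero (f := fun x => M x i j) (fun x hx => ?_)
    (fun x hx => ?_) t (Set.right_mem_Icc.2 ht)
  · exact (h x hx.1).continuousWithinAt.mono Set.Icc_subset_Ici_self
  · exact (h x hx.1).mono (Set.Ici_subset_Ici.2 hx.1)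

theorem bilin_monotoneOn {M M' : ℝ → Matrix (Fin n) (Fin n) ℝ}
    (hM : ∀ x, 0 ≤ x → HasDerivWithinAt M (M' x) (Set.Ici 0) x)
    (hM' : ∀ x, 0 ≤ x → (M' x).PosSemidef) (z : Fin n → ℝ) :
    MonotoneOn (fun x => z ⬝ᵥ (M x *ᵥ z)) (Set.Ici 0) := by
  have h := fun x hx => (hM x hx).matrix_bilin z z
  refine monotoneOn_of_hasDerivWithinAt_nonneg (f' := fun x => z ⬝ᵥ (M' x *ᵥ z)) (convex_Ici 0)
    (fun x hx => (h x hx).continuousWithinAt)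
    (fun x hx => (h x (interior_subset hx)).mono interior_subset) fun x hx => ?_
  simpa using (hM' x (interior_subset hx)).dotProduct_mulVec_nonneg z

/-- Symmetry persists because `M - Mᵀ` has zero derivative; each quadratic form is nondecreasing
from a nonnegative value. -/
theorem Matrix.PosSemidef.of_hasDerivWithinAt {M M' : ℝ → Matrix (Fin n) (Fin n) ℝ}
    (h0 : (M 0).PosSemidef)
    (hM : ∀ x, 0 ≤ x → HasDerivWithinAt M (M' x) (Set.Ici 0) x)
    (hM' : ∀ x, 0 ≤ x → (M' x).PosSemidef) {t : ℝ} (ht : 0 ≤ t) : (M t).PosSemidef := by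
  have symm : ∀ {N : Matrix (Fin n) (Fin n) ℝ}, N.PosSemidef → N - Nᵀ = 0 := fun hN => by
    simpa [sub_eq_zero] using hN.isHermitian.eq.symm
  refine .of_dotProduct_mulVec_nonneg ?_ fun z => ?_
  · have := Matrix.eq_of_hasDerivWithinAt_zero (M := fun x => M x - (M x)ᵀ) (fun x hx => by
      simpa [symm (hM' x hx)] using (hM x hx).matrix_sub (hM x hx).matrix_transpose) ht
    rw [symm h0, sub_eq_zero] at this
    simpa [Matrix.IsHermitian] using this.symm
  · have := bilin_monotoneOn hM hM' z Set.self_mem_Ici ht ht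
    refine le_trans ?_ this
    simpa using h0.dotProduct_mulVec_nonneg z

theorem hasDerivWithinAt_exp_smul_matrix {ι : Type*} [Fintype ι] [DecidableEq ι]
    (H : Matrix ι ι ℝ) (i j : ι) :
    HasDerivWithinAt (fun x : ℝ => NormedSpace.exp (x • H) i j)
      ((H * NormedSpace.exp (t • H)) i j) s t := by
  let : NormedRing (Matrix ι ι ℝ) := Matrix.linftyOpNormedRing
  let : NormedAlgebra ℝ (Matrix ι ι ℝ) := Matrix.linftyOpNormedAlgebra
  have h := hasDerivAt_exp_smul_const' (𝕂 := ℝ) H t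
  let φ : Matrix ι ι ℝ →L[ℝ] ℝ := LinearMap.toContinuousLinearMap (Matrix.entryLinearMap ℝ ℝ i j)
  exact (φ.hasFDerivAt.comp_hasDerivAt t h).hasDerivWithinAt

theorem exists_matrix_exp_flow (A : Matrix (Fin n) (Fin n) ℝ) :
    ∃ E : ℝ → Matrix (Fin n) (Fin n) ℝ, E 0 = 1 ∧ (∀ t, IsUnit (E t)) ∧
      (∀ s t, HasDerivWithinAt E (A * E t) s t) ∧ ∀ t, A * E t = E t * A := by
  refine ⟨fun t => NormedSpace.exp (t • A), by simp, fun t => Matrix.isUnit_exp _, fun s t => ?_,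
    fun t => ?_⟩
  · exact hasDerivWithinAt_matrix.2 fun i j => hasDerivWithinAt_exp_smul_matrix A i j
  · exact ((Commute.refl A).smul_right t).exp_right.eq

end MatrixCalculus

/-! ### The linear Hamiltonian system and invertibility of `U` -/

section HamiltonianFlow

variable {n b c : ℕ}

/-- `(U, V)` is the flow of the Hamiltonian system attached to the Riccati equation with
coefficients `A`, `G`, `Q`, started at `(1, 0)`. -/
structure IsHamiltonianFlow (A G Q : Matrix (Fin n) (Fin n) ℝ)
    (U V : ℝ → Matrix (Fin n) (Fin n) ℝ) : Prop where
  fst_zero : U 0 = 1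
  snd_zero : V 0 = 0
  hasDeriv_fst : ∀ s t, HasDerivWithinAt U (-A * U t + G * V t) s t
  hasDeriv_snd : ∀ s t, HasDerivWithinAt V (Q * U t + Aᵀ * V t) s t

theorem exists_isHamiltonianFlow (A G Q : Matrix (Fin n) (Fin n) ℝ) :
    ∃ U V, IsHamiltonianFlow A G Q U V := by
  -- The flow from (1, 0) is the first block column of exp(tH).
  let H : Matrix (Fin n ⊕ Fin n) (Fin n ⊕ Fin n) ℝ := Matrix.fromBlocks (-A) G Q Aᵀ
  refine ⟨fun t => (NormedSpace.exp (t • H)).toBlocks₁₁,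
    fun t => (NormedSpace.exp (t • H)).toBlocks₂₁, ?_, ?_, fun s t => ?_, fun s t => ?_⟩
  · ext i j
    simp [Matrix.toBlocks₁₁, Matrix.one_apply]
  · ext i j
    simp [Matrix.toBlocks₂₁]
  all_goals
    refine hasDerivWithinAt_matrix.2 fun i j => ?_
    refine (hasDerivWithinAt_exp_smul_matrix H _ _).congr_deriv ?_
    simp [H, Matrix.mul_apply, Matrix.toBlocks₁₁, Matrix.toBlocks₂₁, Matrix.neg_apply]

theorem posSemidef_transpose_mul_self_real {m k : ℕ} (M : Matrix (Fin m) (Fin k) ℝ) :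
    (Mᵀ * M).PosSemidef := by
  simpa using Matrix.posSemidef_conjTranspose_mul_self M

theorem Matrix.PosSemidef.transpose_mul_mul {m k : ℕ} {S : Matrix (Fin m) (Fin m) ℝ}
    (hS : S.PosSemidef) (M : Matrix (Fin m) (Fin k) ℝ) : (Mᵀ * S * M).PosSemidef := by
  simpa using hS.conjTranspose_mul_mul_same M

namespace IsHamiltonianFlow

variable {A : Matrix (Fin n) (Fin n) ℝ} {B : Matrix (Fin n) (Fin b) ℝ}
  {C : Matrix (Fin c) (Fin n) ℝ} {U V : ℝ → Matrix (Fin n) (Fin n) ℝ}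

/-- The terms containing `A` cancel, leaving a sum of two Gram matrices. -/
theorem hasDeriv_transpose_mul (h : IsHamiltonianFlow A (B * Bᵀ) (Cᵀ * C) U V)
    (s : Set ℝ) (t : ℝ) :
    HasDerivWithinAt (fun x => (U x)ᵀ * V x)
      ((Bᵀ * V t)ᵀ * (Bᵀ * V t) + (C * U t)ᵀ * (C * U t)) s t := by
  convert (h.hasDeriv_fst s t).matrix_transpose.matrix_mul (h.hasDeriv_snd s t) using 1
  simp only [Matrix.transpose_add, Matrix.transpose_mul, Matrix.transpose_neg,
    Matrix.transpose_transpose, Matrix.add_mul, Matrix.mul_add, Matrix.neg_mul,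
    Matrix.mul_assoc]
  abel

theorem posSemidef_deriv (t : ℝ) :
    ((Bᵀ * V t)ᵀ * (Bᵀ * V t) + (C * U t)ᵀ * (C * U t)).PosSemidef :=
  (posSemidef_transpose_mul_self_real _).add (posSemidef_transpose_mul_self_real _)

theorem posSemidef_transpose_mul (h : IsHamiltonianFlow A (B * Bᵀ) (Cᵀ * C) U V)
    {t : ℝ} (ht : 0 ≤ t) : ((U t)ᵀ * V t).PosSemidef :=
  Matrix.PosSemidef.of_hasDerivWithinAt (M := fun x => (U x)ᵀ * V x)
    (by simpa [h.snd_zero] using Matrix.PosSemidef.zero)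
    (fun x _ => h.hasDeriv_transpose_mul _ x) (fun x _ => posSemidef_deriv x) ht

/-- If U(t)z = 0, the nondecreasing function zᵀUᵀVz vanishes at 0 and at t, hence between. Its
derivative forces BᵀVz = 0, so Uz solves y' = -Ay on [0, t) and cannot reach 0 unless z = 0. -/
theorem isUnit_fst (h : IsHamiltonianFlow A (B * Bᵀ) (Cᵀ * C) U V)
    {t : ℝ} (ht : 0 ≤ t) : IsUnit (U t) := by
  rw [← Matrix.mulVec_injective_iff_isUnit, ← Matrix.coe_mulVecLin,
    ← LinearMap.ker_eq_bot, LinearMap.ker_eq_bot']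
  intro z hz
  rw [Matrix.mulVecLin_apply] at hz
  have hder := fun x (_ : (0 : ℝ) ≤ x) => h.hasDeriv_transpose_mul (Set.Ici 0) x
  have mono := bilin_monotoneOn hder (fun x _ => posSemidef_deriv x) z
  have hzero : ∀ x ∈ Set.Icc 0 t, z ⬝ᵥ (((U x)ᵀ * V x) *ᵥ z) = 0 := by
    intro x hx
    have h1 := mono Set.self_mem_Ici hx.1 hx.1
    have h2 := mono hx.1 ht hx.2
    have h3 : z ⬝ᵥ (((U t)ᵀ * V t) *ᵥ z) = 0 := by
      rw [← Matrix.mulVec_mulVec, Matrix.dotProduct_mulVec, Matrix.vecMul_transpose, hz,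
        zero_dotProduct]
    simp only [h.snd_zero, Matrix.mul_zero, Matrix.zero_mulVec, dotProduct_zero] at h1
    exact le_antisymm (h3 ▸ h2) h1
  have hBV : ∀ x ∈ Set.Ico 0 t, (Bᵀ * V x) *ᵥ z = 0 := by
    intro x hx
    have hu : UniqueDiffWithinAt ℝ (Set.Icc x t) x :=
      uniqueDiffOn_Icc hx.2 x (Set.left_mem_Icc.2 hx.2.le)
    have h1 := (h.hasDeriv_transpose_mul (Set.Icc x t) x).matrix_bilin z z
    have h2 : HasDerivWithinAt (fun x => z ⬝ᵥ (((U x)ᵀ * V x) *ᵥ z)) 0 (Set.Icc x t) x :=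
      (hasDerivWithinAt_const x _ (0 : ℝ)).congr
        (fun y hy => hzero y ⟨hx.1.trans hy.1, hy.2⟩) (hzero x ⟨hx.1, hx.2.le⟩)
    have h3 := hu.eq_deriv _ h1 h2
    rw [Matrix.add_mulVec, dotProduct_add] at h3
    have h4 := (posSemidef_transpose_mul_self_real (Bᵀ * V x)).dotProduct_mulVec_nonneg z
    have h5 := (posSemidef_transpose_mul_self_real (C * U x)).dotProduct_mulVec_nonneg z
    simp only [star_trivial] at h4 h5
    have h6 : z ⬝ᵥ (((Bᵀ * V x)ᵀ * (Bᵀ * V x)) *ᵥ z) = 0 := by linarith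
    rwa [← Matrix.mulVec_mulVec, Matrix.dotProduct_mulVec, Matrix.vecMul_transpose,
      dotProduct_self_eq_zero] at h6
  obtain ⟨E, hE0, hEu, hE, hEA⟩ := exists_matrix_exp_flow A
  -- With E(t) = exp(tA) as integrating factor, (EUz)' = EB(BᵀVz) = 0.
  have hconst : ∀ i, ((E t * U t) *ᵥ z) i = ((E 0 * U 0) *ᵥ z) i := by
    intro i
    have hd : ∀ s x, HasDerivWithinAt (fun x => ((E x * U x) *ᵥ z) i)
        (((E x * B) *ᵥ ((Bᵀ * V x) *ᵥ z)) i) s x := by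
      intro s x
      have := (((hE s x).matrix_mul (h.hasDeriv_fst s x)).matrix_bilin (Pi.single i 1) z)
      simp only [single_dotProduct, one_mul] at this
      refine this.congr_deriv (congrFun ?_ i)
      rw [Matrix.mulVec_mulVec]
      congr 1
      rw [hEA]
      simp only [Matrix.mul_add, Matrix.mul_neg, Matrix.neg_mul, Matrix.mul_assoc]
      abel
    refine constant_of_has_deriv_right_zero (f := fun x => ((E x * U x) *ᵥ z) i)
      (fun x _ => (hd _ x).continuousWithinAt) (fun x hx => ?_) t (Set.right_mem_Icc.2 ht)
    simpa [hBV x hx] using hd (Set.Ici x) x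
  have := funext hconst
  rw [← Matrix.mulVec_mulVec, hz, hE0, h.fst_zero] at this
  simpa using this.symm

end IsHamiltonianFlow

end HamiltonianFlow

/-! ### Existence, uniqueness and comparison for the differential equation -/

section DifferentialRiccati

variable {n b c : ℕ}

theorem HasDerivWithinAt.matrix_inv {M : ℝ → Matrix (Fin n) (Fin n) ℝ}
    {M' : Matrix (Fin n) (Fin n) ℝ} {s : Set ℝ} {t : ℝ} (hM : HasDerivWithinAt M M' s t)
    (hu : IsUnit (M t)) :
    HasDerivWithinAt (fun x => (M x)⁻¹) (-((M t)⁻¹ * M' * (M t)⁻¹)) s t := by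
  let _ : NormedRing (Matrix (Fin n) (Fin n) ℝ) := Matrix.linftyOpNormedRing
  let _ : NormedAlgebra ℝ (Matrix (Fin n) (Fin n) ℝ) := Matrix.linftyOpNormedAlgebra
  obtain ⟨u, hu⟩ := hu
  have h1 : HasFDerivAt Ring.inverse _ (M t) := hu ▸ hasFDerivAt_ringInverse (𝕜 := ℝ) u
  have h2 := h1.comp_hasDerivWithinAt t hM
  have h3 : (-ContinuousLinearMap.mulLeftRight ℝ (Matrix (Fin n) (Fin n) ℝ) ↑u⁻¹ ↑u⁻¹) M' =
      -((M t)⁻¹ * M' * (M t)⁻¹) := by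
    rw [← hu, ← Matrix.coe_units_inv]
    rfl
  have h4 : (fun x => (M x)⁻¹) = Ring.inverse ∘ M :=
    funext fun x => Matrix.nonsing_inv_eq_ringInverse (M x)
  rw [h3] at h2
  rw [h4]
  exact h2

theorem HasDerivWithinAt.matrix_continuousWithinAt {M : ℝ → Matrix (Fin n) (Fin n) ℝ}
    {M' : Matrix (Fin n) (Fin n) ℝ} {s : Set ℝ} {t : ℝ} (hM : HasDerivWithinAt M M' s t) :
    ContinuousWithinAt M s t := by
  let _ : NormedRing (Matrix (Fin n) (Fin n) ℝ) := Matrix.linftyOpNormedRing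
  let _ : NormedAlgebra ℝ (Matrix (Fin n) (Fin n) ℝ) := Matrix.linftyOpNormedAlgebra
  exact hM.continuousWithinAt

/-- Continuity bounds `L` on the compact interval [0, t], so the linear equation is Lipschitz there.
-/
theorem eq_zero_of_hasDerivWithinAt_mul {L E : ℝ → Matrix (Fin n) (Fin n) ℝ}
    (hL : ContinuousOn L (Set.Ici 0)) (h0 : E 0 = 0)
    (hE : ∀ x, 0 ≤ x → HasDerivWithinAt E (L x * E x) (Set.Ici 0) x) {t : ℝ} (ht : 0 ≤ t) :
    E t = 0 := by
  let _ : NormedRing (Matrix (Fin n) (Fin n) ℝ) := Matrix.linftyOpNormedRing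
  let _ : NormedAlgebra ℝ (Matrix (Fin n) (Fin n) ℝ) := Matrix.linftyOpNormedAlgebra
  have hL' : ContinuousOn L (Set.Icc 0 t) := hL.mono Set.Icc_subset_Ici_self
  obtain ⟨K, hK⟩ := isCompact_Icc.exists_bound_of_continuousOn hL'
  have hlip : ∀ x ∈ Set.Ico 0 t, LipschitzOnWith K.toNNReal
      (fun N : Matrix (Fin n) (Fin n) ℝ => L x * N) Set.univ := by
    intro x hx
    refine LipschitzOnWith.of_dist_le_mul fun M _ N _ => ?_
    rw [dist_eq_norm, dist_eq_norm, ← mul_sub]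
    refine (norm_mul_le _ _).trans (mul_le_mul_of_nonneg_right ?_ (norm_nonneg _))
    exact (hK x ⟨hx.1, hx.2.le⟩).trans (Real.le_coe_toNNReal K)
  refine ODE_solution_unique_of_mem_Icc_right (f := E) (g := fun _ => 0) hlip
    (fun x hx => ((hE x hx.1).continuousWithinAt).mono Set.Icc_subset_Ici_self)
    (fun x hx => (hE x hx.1).mono (Set.Ici_subset_Ici.2 hx.1)) (fun _ _ => Set.mem_univ _)
    continuousOn_const (fun x hx => ?_) (fun _ _ => Set.mem_univ _) h0 (Set.right_mem_Icc.2 ht)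
  simpa using hasDerivWithinAt_const x (Set.Ici x) (0 : Matrix (Fin n) (Fin n) ℝ)

namespace IsHamiltonianFlow

variable {A : Matrix (Fin n) (Fin n) ℝ} {B : Matrix (Fin n) (Fin b) ℝ}
  {C : Matrix (Fin c) (Fin n) ℝ} {U V : ℝ → Matrix (Fin n) (Fin n) ℝ}

theorem isSolutionDRE (h : IsHamiltonianFlow A (B * Bᵀ) (Cᵀ * C) U V) :
    IsSolutionDRE A B C 0 fun t => V t * (U t)⁻¹ := by
  refine ⟨by simp [h.snd_zero], fun t ht => ?_⟩
  have hu := h.isUnit_fst ht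
  convert (h.hasDeriv_snd _ t).matrix_mul ((h.hasDeriv_fst _ t).matrix_inv hu) using 1
  have hu' : U t * (U t)⁻¹ = 1 := Matrix.mul_nonsing_inv _ ((Matrix.isUnit_iff_isUnit_det _).1 hu)
  simp only [riccati, Matrix.add_mul, Matrix.mul_add, Matrix.neg_mul, Matrix.mul_neg,
    Matrix.mul_assoc, hu', Matrix.mul_one]
  abel

/-- The defect YU - V satisfies a homogeneous linear equation with coefficient Aᵀ - YBBᵀ and starts
at 0. -/
theorem eqOn_of_isSolutionDRE (h : IsHamiltonianFlow A (B * Bᵀ) (Cᵀ * C) U V)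
    {Y : ℝ → Matrix (Fin n) (Fin n) ℝ} (hY : IsSolutionDRE A B C 0 Y) {t : ℝ} (ht : 0 ≤ t) :
    Y t = V t * (U t)⁻¹ := by
  have hE : Y t * U t - V t = 0 := by
    refine eq_zero_of_hasDerivWithinAt_mul (L := fun x => Aᵀ - Y x * (B * Bᵀ))
      (E := fun x => Y x * U x - V x) (fun x hx => ?_) ?_ (fun x hx => ?_) ht
    · exact ((hasDerivWithinAt_matrix_const Aᵀ).matrix_sub
        ((hY.2 x hx).matrix_mul_const (B * Bᵀ))).matrix_continuousWithinAt
    · simp [hY.1, h.snd_zero]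
    · convert ((hY.2 x hx).matrix_mul (h.hasDeriv_fst _ x)).matrix_sub (h.hasDeriv_snd _ x) using 1
      simp only [riccati, Matrix.add_mul, Matrix.mul_add, Matrix.sub_mul, Matrix.mul_sub,
        Matrix.neg_mul, Matrix.mul_neg, Matrix.mul_assoc]
      abel
  rw [← sub_eq_zero.1 hE, Matrix.mul_nonsing_inv_cancel_right]
  exact (Matrix.isUnit_iff_isUnit_det _).1 (h.isUnit_fst ht)

end IsHamiltonianFlow

variable {A : Matrix (Fin n) (Fin n) ℝ} {B : Matrix (Fin n) (Fin b) ℝ}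
  {C : Matrix (Fin c) (Fin n) ℝ}

theorem exists_unique_isSolutionDRE (A : Matrix (Fin n) (Fin n) ℝ) (B : Matrix (Fin n) (Fin b) ℝ)
    (C : Matrix (Fin c) (Fin n) ℝ) :
    ∃ X : ℝ → Matrix (Fin n) (Fin n) ℝ, IsSolutionDRE A B C 0 X ∧
      ∀ Y : ℝ → Matrix (Fin n) (Fin n) ℝ, IsSolutionDRE A B C 0 Y →
        Set.EqOn Y X (Set.Ici 0) := by
  obtain ⟨U, V, h⟩ := exists_isHamiltonianFlow A (B * Bᵀ) (Cᵀ * C)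
  exact ⟨_, h.isSolutionDRE, fun Y hY t ht => h.eqOn_of_isSolutionDRE hY ht⟩

namespace IsSolutionDRE

variable {X : ℝ → Matrix (Fin n) (Fin n) ℝ}

theorem exists_flow (hX : IsSolutionDRE A B C 0 X) :
    ∃ U V, IsHamiltonianFlow A (B * Bᵀ) (Cᵀ * C) U V ∧
      (∀ t, 0 ≤ t → U t * (U t)⁻¹ = 1) ∧ ∀ t, 0 ≤ t → X t * U t = V t := by
  obtain ⟨U, V, h⟩ := exists_isHamiltonianFlow A (B * Bᵀ) (Cᵀ * C)
  have hu := fun t ht => (Matrix.isUnit_iff_isUnit_det _).1 (h.isUnit_fst (t := t) ht)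
  refine ⟨U, V, h, fun t ht => Matrix.mul_nonsing_inv _ (hu t ht), fun t ht => ?_⟩
  rw [h.eqOn_of_isSolutionDRE hX ht, Matrix.nonsing_inv_mul_cancel_right _ _ (hu t ht)]

theorem _root_.Matrix.PosSemidef.of_transpose_mul_mul {S U W : Matrix (Fin n) (Fin n) ℝ}
    (h : (Uᵀ * S * U).PosSemidef) (hW : U * W = 1) : S.PosSemidef := by
  have hW' : Wᵀ * Uᵀ = 1 := by rw [← Matrix.transpose_mul, hW, Matrix.transpose_one]
  have := h.transpose_mul_mul W
  rwa [show Wᵀ * (Uᵀ * S * U) * W = (Wᵀ * Uᵀ) * S * (U * W) by simp only [Matrix.mul_assoc],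
    hW, hW', Matrix.mul_one, Matrix.one_mul] at this

theorem posSemidef (hX : IsSolutionDRE A B C 0 X) {t : ℝ} (ht : 0 ≤ t) : (X t).PosSemidef := by
  obtain ⟨U, V, h, hU, hXU⟩ := hX.exists_flow
  refine .of_transpose_mul_mul ?_ (hU t ht)
  rw [Matrix.mul_assoc, hXU t ht]
  exact h.posSemidef_transpose_mul ht

/-- UᵀR(X)U, written in U and V, is the Hamiltonian form conserved by the flow; its value at 0 is
CᵀC. -/
theorem posSemidef_riccati (hX : IsSolutionDRE A B C 0 X) {t : ℝ} (ht : 0 ≤ t) :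
    (riccati A B C (X t)).PosSemidef := by
  obtain ⟨U, V, h, hU, hXU⟩ := hX.exists_flow
  refine .of_transpose_mul_mul ?_ (hU t ht)
  have hXt : (X t)ᵀ = X t := by simpa using (hX.posSemidef ht).isHermitian.eq
  have hUX : (U t)ᵀ * X t = (V t)ᵀ := by rw [← hXU t ht, Matrix.transpose_mul, hXt]
  have hconst := Matrix.eq_of_hasDerivWithinAt_zero (M := fun x => (U x)ᵀ * Aᵀ * V x +
      (V x)ᵀ * A * U x - (V x)ᵀ * (B * Bᵀ) * V x + (U x)ᵀ * (Cᵀ * C) * U x) (fun x _ => by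
    have hu := h.hasDeriv_fst (Set.Ici 0) x
    have hv := h.hasDeriv_snd (Set.Ici 0) x
    convert ((((hu.matrix_transpose.matrix_mul_const Aᵀ).matrix_mul hv).matrix_add
      ((hv.matrix_transpose.matrix_mul_const A).matrix_mul hu)).matrix_sub
      ((hv.matrix_transpose.matrix_mul_const (B * Bᵀ)).matrix_mul hv)).matrix_add
      ((hu.matrix_transpose.matrix_mul_const (Cᵀ * C)).matrix_mul hu) using 1
    simp only [Matrix.transpose_add, Matrix.transpose_mul, Matrix.transpose_neg,
      Matrix.transpose_transpose, Matrix.add_mul, Matrix.mul_add, Matrix.mul_neg, Matrix.neg_mul,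
      Matrix.mul_assoc]
    abel) ht
  have : (U t)ᵀ * riccati A B C (X t) * U t = Cᵀ * C := by
    calc (U t)ᵀ * riccati A B C (X t) * U t
        = (U t)ᵀ * Aᵀ * (X t * U t) + ((U t)ᵀ * X t) * A * U t -
          ((U t)ᵀ * X t) * (B * Bᵀ) * (X t * U t) + (U t)ᵀ * (Cᵀ * C) * U t := by
          simp only [riccati, Matrix.add_mul, Matrix.mul_add, Matrix.sub_mul, Matrix.mul_sub,
            Matrix.mul_assoc]
      _ = Cᵀ * C := by
          rw [hXU t ht, hUX]
          simpa [h.fst_zero, h.snd_zero] using hconst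
  rw [this]
  exact posSemidef_transpose_mul_self_real C

/-- The solution of the differential Riccati equation stays below every positive semidefinite
supersolution of the algebraic one. -/
theorem le_of_supersolution (hX : IsSolutionDRE A B C 0 X) {P : Matrix (Fin n) (Fin n) ℝ}
    (hP : P.PosSemidef) (hRP : (-riccati A B C P).PosSemidef) {t : ℝ} (ht : 0 ≤ t) :
    (P - X t).PosSemidef := by
  -- With F = A - BBᵀP and D = P - X, D' = FᵀD + DF + DBBᵀD - R(P). Congruence by exp(-tF) removes
  -- the linear terms.
  obtain ⟨E, hE0, hEu, hE, hEA⟩ := exists_matrix_exp_flow (-(A - B * Bᵀ * P))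
  have hPt : Pᵀ = P := by simpa using hP.isHermitian.eq
  have key : ((E t)ᵀ * (P - X t) * E t).PosSemidef := by
    refine Matrix.PosSemidef.of_hasDerivWithinAt (M := fun x => (E x)ᵀ * (P - X x) * E x)
      (M' := fun x => (E x)ᵀ * ((Bᵀ * (P - X x))ᵀ * (Bᵀ * (P - X x)) + -riccati A B C P) * E x)
      ?_ (fun x hx => ?_) (fun x hx => ?_) ht
    · simpa [hX.1, hE0] using hP
    · convert ((hE _ x).matrix_transpose.matrix_mul
        ((hasDerivWithinAt_matrix_const P).matrix_sub (hX.2 x hx))).matrix_mul (hE _ x) using 1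
      have hXt : (X x)ᵀ = X x := by simpa using (hX.posSemidef hx).isHermitian.eq
      simp only [riccati, Matrix.transpose_mul, Matrix.transpose_neg,
        Matrix.transpose_sub, hPt, hXt,
        Matrix.transpose_transpose, Matrix.add_mul, Matrix.mul_add, Matrix.mul_neg, Matrix.neg_mul,
        Matrix.sub_mul, Matrix.mul_sub, Matrix.mul_assoc, zero_sub]
      abel
    · exact ((posSemidef_transpose_mul_self_real _).add hRP).transpose_mul_mul _
  exact key.of_transpose_mul_mul
    (Matrix.mul_nonsing_inv _ ((Matrix.isUnit_iff_isUnit_det _).1 (hEu t)))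

end IsSolutionDRE

end DifferentialRiccati

/-! ### Convergence to a solution of the algebraic equation -/

section SteadyState

open Filter Topology

variable {n b c : ℕ}

theorem Matrix.PosSemidef.of_tendsto {ι : Type*} {l : Filter ι} [l.NeBot]
    {M : ι → Matrix (Fin n) (Fin n) ℝ} {P : Matrix (Fin n) (Fin n) ℝ}
    (hM : Tendsto M l (𝓝 P)) (h : ∀ᶠ x in l, (M x).PosSemidef) : P.PosSemidef := by
  refine .of_dotProduct_mulVec_nonneg ?_ fun z => ?_
  · refine tendsto_nhds_unique ((continuous_id.matrix_conjTranspose.tendsto P).comp hM)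
      (hM.congr' ?_)
    filter_upwards [h] with x hx
    exact hx.isHermitian.eq.symm
  · have hc : Continuous fun N : Matrix (Fin n) (Fin n) ℝ => star z ⬝ᵥ (N *ᵥ z) := by fun_prop
    refine ge_of_tendsto ((hc.tendsto P).comp hM) ?_
    filter_upwards [h] with x hx
    exact hx.dotProduct_mulVec_nonneg z

/-- By the mean value theorem on [t, t + 1], `f'` takes the value f(t + 1) - f(t), which tends to 0.
-/
theorem eq_zero_of_tendsto_of_tendsto_deriv {f f' : ℝ → ℝ} {l L : ℝ}
    (hf : ∀ x, 0 ≤ x → HasDerivWithinAt f (f' x) (Set.Ici 0) x)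
    (hl : Tendsto f atTop (𝓝 l)) (hL : Tendsto f' atTop (𝓝 L)) : L = 0 := by
  have hmvt : ∀ t : ℝ, ∃ x, t ≤ x ∧ (0 ≤ t → f' x = f (t + 1) - f t) := by
    intro t
    by_cases ht : 0 ≤ t
    · obtain ⟨x, hx, hfx⟩ := exists_hasDerivAt_eq_slope f f' (lt_add_one t)
        (fun y hy => ((hf y (ht.trans hy.1)).continuousWithinAt).mono
          fun w hw => ht.trans hw.1)
        (fun y hy => (hf y (ht.trans hy.1.le)).hasDerivAt (Ici_mem_nhds (ht.trans_lt hy.1)))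
      exact ⟨x, hx.1.le, fun _ => by simpa using hfx⟩
    · exact ⟨t, le_rfl, fun h => absurd h ht⟩
  choose x hx hfx using hmvt
  have h1 : Tendsto (fun t => f' (x t)) atTop (𝓝 L) :=
    hL.comp (tendsto_atTop_mono hx tendsto_id)
  have h2 : Tendsto (fun t => f (t + 1) - f t) atTop (𝓝 (l - l)) :=
    (hl.comp (tendsto_atTop_add_const_right _ 1 tendsto_id)).sub hl
  rw [sub_self] at h2
  refine tendsto_nhds_unique h1 (h2.congr' ?_)
  filter_upwards [eventually_ge_atTop 0] with t ht
  exact (hfx t ht).symm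

theorem Matrix.apply_eq_polarization {M : Matrix (Fin n) (Fin n) ℝ} (hM : Mᵀ = M)
    (i j : Fin n) :
    M i j = ((Pi.single i 1 + Pi.single j 1) ⬝ᵥ (M *ᵥ (Pi.single i 1 + Pi.single j 1)) -
      Pi.single i 1 ⬝ᵥ (M *ᵥ Pi.single i 1) - Pi.single j 1 ⬝ᵥ (M *ᵥ Pi.single j 1)) / 2 := by
  have : M j i = M i j := congrFun (congrFun hM i) j
  simp [Matrix.mulVec_add, this]
  ring

variable {A : Matrix (Fin n) (Fin n) ℝ} {B : Matrix (Fin n) (Fin b) ℝ}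
  {C : Matrix (Fin c) (Fin n) ℝ} {X : ℝ → Matrix (Fin n) (Fin n) ℝ}

/-- Each quadratic form of X is nondecreasing and bounded by that of `P`; polarization recovers the
entries. -/
theorem IsSolutionDRE.exists_tendsto (hX : IsSolutionDRE A B C 0 X)
    {P : Matrix (Fin n) (Fin n) ℝ} (hP : P.PosSemidef) (hRP : (-riccati A B C P).PosSemidef) :
    ∃ S, Tendsto X atTop (𝓝 S) := by
  have hq : ∀ z : Fin n → ℝ, ∃ l, Tendsto (fun t => z ⬝ᵥ (X t *ᵥ z)) atTop (𝓝 l) := by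
    intro z
    have mono := bilin_monotoneOn hX.2 (fun x hx => hX.posSemidef_riccati hx) z
    have hle : ∀ t, 0 ≤ t → z ⬝ᵥ (X t *ᵥ z) ≤ z ⬝ᵥ (P *ᵥ z) := by
      intro t ht
      have := (hX.le_of_supersolution hP hRP ht).dotProduct_mulVec_nonneg z
      rwa [star_trivial, Matrix.sub_mulVec, dotProduct_sub, sub_nonneg] at this
    have mono' : Monotone fun t => z ⬝ᵥ (X (max t 0) *ᵥ z) := fun s t hst =>
      mono (le_max_right s 0) (le_max_right t 0) (max_le_max_right 0 hst)
    have hlim := tendsto_atTop_ciSup mono' ⟨_, by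
      rintro _ ⟨t, rfl⟩
      exact hle _ (le_max_right t 0)⟩
    refine ⟨_, hlim.congr' ?_⟩
    filter_upwards [eventually_ge_atTop 0] with t ht
    rw [max_eq_left ht]
  choose l hl using hq
  refine ⟨Matrix.of fun i j => (l (Pi.single i 1 + Pi.single j 1) - l (Pi.single i 1) -
    l (Pi.single j 1)) / 2, tendsto_pi_nhds.2 fun i => tendsto_pi_nhds.2 fun j => ?_⟩
  refine ((((hl _).sub (hl _)).sub (hl _)).div_const 2).congr' ?_
  filter_upwards [eventually_ge_atTop 0] with t ht
  refine (Matrix.apply_eq_polarization ?_ i j).symm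
  simpa using (hX.posSemidef ht).isHermitian.eq

theorem exists_isPSDSolutionARE_of_supersolution
    {P : Matrix (Fin n) (Fin n) ℝ} (hP : P.PosSemidef) (hRP : (-riccati A B C P).PosSemidef) :
    ∃ S, IsPSDSolutionARE A B C S := by
  obtain ⟨X, hX, -⟩ := exists_unique_isSolutionDRE A B C
  obtain ⟨S, hS⟩ := hX.exists_tendsto hP hRP
  refine ⟨S, .of_tendsto hS ?_, ?_⟩
  · filter_upwards [eventually_ge_atTop 0] with t ht
    exact hX.posSemidef ht
  · have hc : Continuous (riccati A B C) := by unfold riccati; fun_prop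
    ext i j
    refine eq_zero_of_tendsto_of_tendsto_deriv
      (fun x hx => hasDerivWithinAt_matrix.1 (hX.2 x hx) i j)
      (tendsto_pi_nhds.1 (tendsto_pi_nhds.1 hS i) j)
      (tendsto_pi_nhds.1 (tendsto_pi_nhds.1 ((hc.tendsto S).comp hS) i) j)

end SteadyState

/-! ### Stable matrices: Cayley transform, Sylvester and Lyapunov equations -/

section Stability

open Filter Topology

variable {n b c : ℕ}

/-- Gelfand's formula, with `r` strictly between the spectral radius and 1. -/
theorem exists_forall_norm_pow_apply_le {a : Matrix (Fin n) (Fin n) ℂ}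
    (ha : ∀ z ∈ spectrum ℂ a, ‖z‖ < 1) :
    ∃ r : ℝ, 0 ≤ r ∧ r < 1 ∧ ∀ᶠ k : ℕ in atTop, ∀ i j, ‖(a ^ k) i j‖ ≤ r ^ k := by
  let _ : NormedRing (Matrix (Fin n) (Fin n) ℂ) := Matrix.linftyOpNormedRing
  let _ : NormedAlgebra ℂ (Matrix (Fin n) (Fin n) ℂ) := Matrix.linftyOpNormedAlgebra
  have hρ : spectralRadius ℂ a < 1 := by
    rcases (spectrum ℂ a).eq_empty_or_nonempty with h | h
    · simp [spectralRadius, h]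
    · exact_mod_cast spectrum.spectralRadius_lt_of_forall_lt_of_nonempty h (r := 1)
        fun z hz => by exact_mod_cast ha z hz
  obtain ⟨r, hr, hr1⟩ := ENNReal.lt_iff_exists_nnreal_btwn.1 hρ
  refine ⟨r, r.2, by exact_mod_cast hr1, ?_⟩
  filter_upwards [(spectrum.pow_nnnorm_pow_one_div_tendsto_nhds_spectralRadius a).eventually_lt_const
    hr, eventually_gt_atTop 0] with k hk hk0 i j
  have h1 : ‖a ^ k‖₊ ≤ r ^ k := by
    have h2 := ENNReal.rpow_le_rpow hk.le (Nat.cast_nonneg (α := ℝ) k)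
    rw [← ENNReal.rpow_mul, one_div, inv_mul_cancel₀ (by exact_mod_cast hk0.ne'),
      ENNReal.rpow_one, ENNReal.rpow_natCast] at h2
    exact_mod_cast h2
  refine le_trans ?_ (show ‖a ^ k‖ ≤ (r : ℝ) ^ k by exact_mod_cast h1)
  rw [Matrix.linfty_opNorm_def]
  have h3 : ‖(a ^ k) i j‖₊ ≤ ∑ j, ‖(a ^ k) i j‖₊ :=
    Finset.single_le_sum (f := fun j => ‖(a ^ k) i j‖₊) (fun _ _ => zero_le) (Finset.mem_univ j)
  have h4 := Finset.le_sup (f := fun i => ∑ j, ‖(a ^ k) i j‖₊) (Finset.mem_univ i)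
  exact_mod_cast h3.trans h4

/-- λ ↦ (λ + 1)/(λ - 1) maps the open left half plane into the open unit disc. -/
theorem IsStableMatrix.exists_cayley {F : Matrix (Fin n) (Fin n) ℝ} (hF : IsStableMatrix F) :
    ∃ R : Matrix (Fin n) (Fin n) ℝ, R * (F - 1) = 1 ∧ (F - 1) * R = 1 ∧
      ∃ r : ℝ, 0 ≤ r ∧ r < 1 ∧ ∀ᶠ k : ℕ in atTop, ∀ i j, |(((F + 1) * R) ^ k) i j| ≤ r ^ k := by
  let φ : Matrix (Fin n) (Fin n) ℝ →+* Matrix (Fin n) (Fin n) ℂ :=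
    (algebraMap ℝ ℂ).mapMatrix
  have hunit : ∀ w : ℂ, 0 ≤ w.re → IsUnit (algebraMap ℂ (Matrix (Fin n) (Fin n) ℂ) w - φ F) :=
    fun w hw => not_not.1 fun h => (hF w h).not_ge hw
  have hdet : IsUnit (F - 1).det := by
    have h1 := (hunit 1 zero_le_one).neg
    rw [map_one, neg_sub, ← map_one φ, ← map_sub, Matrix.isUnit_iff_isUnit_det,
      ← RingHom.map_det] at h1
    rw [isUnit_iff_ne_zero] at h1 ⊢
    exact fun h => h1 (by rw [h, map_zero])
  have hR1 := Matrix.nonsing_inv_mul _ hdet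
  have hR2 := Matrix.mul_nonsing_inv _ hdet
  set R := (F - 1)⁻¹
  have hφ1 : φ R * (φ F - 1) = 1 := by rw [← map_one φ, ← map_sub, ← map_mul, hR1]
  have hφ2 : (φ F - 1) * φ R = 1 := by rw [← map_one φ, ← map_sub, ← map_mul, hR2]
  have hu : IsUnit (φ F - 1) := ⟨⟨_, _, hφ2, hφ1⟩, rfl⟩
  refine ⟨R, hR1, hR2, ?_⟩
  obtain ⟨r, hr0, hr1, hr⟩ := exists_forall_norm_pow_apply_le (a := φ ((F + 1) * R)) (by
    intro z hz
    by_contra! hz1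
    refine hz ?_
    have hfac : (algebraMap ℂ (Matrix (Fin n) (Fin n) ℂ) z - φ ((F + 1) * R)) * (φ F - 1) =
        (z - 1) • φ F - (z + 1) • (1 : Matrix (Fin n) (Fin n) ℂ) := by
      rw [map_mul, sub_mul, mul_assoc, hφ1, map_add, map_one, Algebra.algebraMap_eq_smul_one]
      simp only [smul_one_mul, mul_one, smul_sub, sub_smul, add_smul, one_smul]
      abel
    -- For z = 1 this is -2. Otherwise it is -(z - 1)(w - F) with w = (z + 1)/(z - 1), and |z| ≥ 1
    -- gives Re w ≥ 0, so w is not an eigenvalue of F.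
    have hfacu : IsUnit ((z - 1) • φ F - (z + 1) • (1 : Matrix (Fin n) (Fin n) ℂ)) := by
      by_cases h1 : z = 1
      · rw [h1, sub_self, zero_smul, zero_sub, IsUnit.neg_iff, ← Algebra.algebraMap_eq_smul_one]
        exact (isUnit_iff_ne_zero.2 (by norm_num)).map _
      · have hz0 : z - 1 ≠ 0 := sub_ne_zero.2 h1
        have hre : 0 ≤ ((z + 1) / (z - 1)).re := by
          rw [Complex.div_re, ← add_div]
          refine div_nonneg ?_ (Complex.normSq_nonneg _)
          have h2 : 1 ≤ z.re * z.re + z.im * z.im := by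
            rw [← Complex.normSq_apply, Complex.normSq_eq_norm_sq]
            nlinarith
          simp
          nlinarith
        have h3 := (hunit _ hre)
        have h4 : (z - 1) • φ F - (z + 1) • (1 : Matrix (Fin n) (Fin n) ℂ) =
            algebraMap ℂ (Matrix (Fin n) (Fin n) ℂ) (-(z - 1)) *
              (algebraMap ℂ (Matrix (Fin n) (Fin n) ℂ) ((z + 1) / (z - 1)) - φ F) := by
          rw [mul_sub, ← map_mul, neg_mul, mul_div_cancel₀ _ hz0, Algebra.algebraMap_eq_smul_one,
            Algebra.algebraMap_eq_smul_one, smul_one_mul]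
          simp only [neg_smul]
          abel
        rw [h4]
        exact ((isUnit_iff_ne_zero.2 (neg_ne_zero.2 hz0)).map _).mul h3
    rw [← hfac] at hfacu
    have := hfacu.mul (show IsUnit (φ R) from ⟨⟨_, _, hφ1, hφ2⟩, rfl⟩)
    rwa [mul_assoc, hφ2, mul_one] at this)
  refine ⟨r, hr0, hr1, hr.mono fun k hk i j => ?_⟩
  have := hk i j
  rw [← map_pow] at this
  simpa [φ] using this

theorem summable_transpose_pow_mul_mul_pow {M₁ M₂ : Matrix (Fin n) (Fin n) ℝ}
    (D : Matrix (Fin n) (Fin n) ℝ) {r₁ r₂ : ℝ} (hr₁ : 0 ≤ r₁) (hr₁' : r₁ < 1) (hr₂ : 0 ≤ r₂)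
    (hr₂' : r₂ < 1)
    (h₁ : ∀ᶠ k : ℕ in atTop, ∀ i j, |(M₁ ^ k) i j| ≤ r₁ ^ k)
    (h₂ : ∀ᶠ k : ℕ in atTop, ∀ i j, |(M₂ ^ k) i j| ≤ r₂ ^ k) :
    Summable fun k : ℕ => (M₁ ^ k)ᵀ * D * M₂ ^ k := by
  refine Pi.summable.2 fun i => Pi.summable.2 fun j => ?_
  simp only [Matrix.mul_apply, Finset.sum_mul, Matrix.transpose_apply]
  refine summable_sum fun x _ => summable_sum fun y _ => ?_
  refine Summable.of_norm_bounded_eventually_nat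
    ((summable_geometric_of_lt_one hr₁ hr₁').mul_right |D y x|) ?_
  filter_upwards [h₁, h₂] with k h1 h2
  rw [Real.norm_eq_abs, abs_mul, abs_mul]
  calc _ ≤ r₁ ^ k * |D y x| * 1 := by
        gcongr
        · exact h1 _ _
        · exact (h2 _ _).trans (pow_le_one₀ hr₂ hr₂'.le)
    _ = _ := mul_one _

/-- For the Cayley transforms the equation reads M₁ᵀDM₂ = D. Iterating, `D` is every term of a
summable series. -/
theorem IsStableMatrix.sylvester_eq_zero {F₁ F₂ D : Matrix (Fin n) (Fin n) ℝ}
    (h₁ : IsStableMatrix F₁) (h₂ : IsStableMatrix F₂) (hD : F₁ᵀ * D + D * F₂ = 0) : D = 0 := by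
  obtain ⟨R₁, hR₁, hR₁', r₁, hr₁, hr₁', hM₁⟩ := h₁.exists_cayley
  obtain ⟨R₂, hR₂, hR₂', r₂, hr₂, hr₂', hM₂⟩ := h₂.exists_cayley
  have hfix : ((F₁ + 1) * R₁)ᵀ * D * ((F₂ + 1) * R₂) = D := by
    have h3 : (F₁ + 1)ᵀ * D * (F₂ + 1) = (F₁ - 1)ᵀ * D * (F₂ - 1) := by
      rw [← sub_eq_zero]
      calc _ = (2 : ℕ) • (F₁ᵀ * D + D * F₂) := by
            simp only [Matrix.transpose_add, Matrix.transpose_sub, Matrix.transpose_one]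
            noncomm_ring
        _ = 0 := by rw [hD, smul_zero]
    calc _ = R₁ᵀ * ((F₁ + 1)ᵀ * D * (F₂ + 1)) * R₂ := by
          simp only [Matrix.transpose_mul, Matrix.mul_assoc]
      _ = ((F₁ - 1) * R₁)ᵀ * D * ((F₂ - 1) * R₂) := by
          rw [h3]; simp only [Matrix.transpose_mul, Matrix.mul_assoc]
      _ = D := by rw [hR₁', hR₂']; simp
  have hpow : ∀ k : ℕ, (((F₁ + 1) * R₁) ^ k)ᵀ * D * ((F₂ + 1) * R₂) ^ k = D := by
    intro k
    induction k with
    | zero => simp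
    | succ k ih =>
      calc _ = ((F₁ + 1) * R₁)ᵀ * ((((F₁ + 1) * R₁) ^ k)ᵀ * D * ((F₂ + 1) * R₂) ^ k) *
            ((F₂ + 1) * R₂) := by
            rw [pow_succ, pow_succ, Matrix.transpose_mul]
            simp only [Matrix.mul_assoc]
        _ = D := by rw [ih, hfix]
  have hs := summable_transpose_pow_mul_mul_pow D hr₁ hr₁' hr₂ hr₂' hM₁ hM₂
  simp only [hpow] at hs
  exact tendsto_nhds_unique tendsto_const_nhds hs.tendsto_atTop_zero

theorem IsStableMatrix.exists_lyapunov {F Y : Matrix (Fin n) (Fin n) ℝ} (hF : IsStableMatrix F)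
    (hY : Y.PosSemidef) :
    ∃ P : Matrix (Fin n) (Fin n) ℝ, P.PosSemidef ∧ Fᵀ * P + P * F = -Y := by
  obtain ⟨R, hR, hR', r, hr, hr', hM⟩ := hF.exists_cayley
  set M := (F + 1) * R with hMdef
  -- The series P = ∑ (Mᵏ)ᵀWMᵏ solves P - W = MᵀPM. The factor 2 comes from (F + 1)ᵀP(F + 1) - (F -
  -- 1)ᵀP(F - 1) = 2(FᵀP + PF).
  have hW : (Rᵀ * ((2 : ℝ) • Y) * R).PosSemidef := (hY.smul zero_le_two).transpose_mul_mul R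
  set W := Rᵀ * ((2 : ℝ) • Y) * R with hWdef
  obtain ⟨P, hP⟩ := summable_transpose_pow_mul_mul_pow W hr hr' hr hr' hM hM
  have hstep : P - W = Mᵀ * P * M := by
    have h1 := (hasSum_nat_add_iff' 1).2 hP
    simp only [Finset.range_one, Finset.sum_singleton, pow_zero, Matrix.transpose_one,
      Matrix.one_mul, Matrix.mul_one] at h1
    refine h1.unique (((hP.mul_left Mᵀ).mul_right M).congr_fun ?_)
    intro k
    rw [pow_succ, Matrix.transpose_mul]
    simp only [Matrix.mul_assoc]
  refine ⟨P, .of_tendsto hP.tendsto_sum_nat (.of_forall fun m =>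
    Matrix.posSemidef_sum _ fun k _ => hW.transpose_mul_mul _), ?_⟩
  have h2 : (F - 1)ᵀ * P * (F - 1) - (2 : ℝ) • Y = (F + 1)ᵀ * P * (F + 1) := by
    have hRt : (F - 1)ᵀ * Rᵀ = 1 := by rw [← Matrix.transpose_mul, hR, Matrix.transpose_one]
    calc _ = (F - 1)ᵀ * P * (F - 1) - ((F - 1)ᵀ * Rᵀ) * ((2 : ℝ) • Y) * (R * (F - 1)) := by
          rw [hRt, hR, Matrix.one_mul, Matrix.mul_one]
      _ = (F - 1)ᵀ * (P - W) * (F - 1) := by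
          rw [hWdef, Matrix.mul_sub (F - 1)ᵀ P, Matrix.sub_mul _ _ (F - 1)]
          simp only [Matrix.mul_assoc]
      _ = ((F - 1)ᵀ * Rᵀ) * ((F + 1)ᵀ * P * (F + 1)) * (R * (F - 1)) := by
          rw [hstep, hMdef]; simp only [Matrix.transpose_mul, Matrix.mul_assoc]
      _ = _ := by rw [hRt, hR, Matrix.one_mul, Matrix.mul_one]
  have h3 : (2 : ℝ) • (Fᵀ * P + P * F) = (2 : ℝ) • (-Y) := by
    rw [smul_neg, ← sub_sub_cancel ((F - 1)ᵀ * P * (F - 1)) ((2 : ℝ) • Y), h2]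
    simp only [Matrix.transpose_add, Matrix.transpose_sub, Matrix.transpose_one, two_smul]
    noncomm_ring
  exact smul_right_injective _ (two_ne_zero' ℝ) h3

end Stability

/-! ### Existence and uniqueness for the algebraic equation -/

section AlgebraicRiccati

variable {n b c : ℕ}

/-- `u` and `v` are the real and imaginary parts of a complex eigenvector. -/
theorem mem_spectrum_map_iff {F : Matrix (Fin n) (Fin n) ℝ} {z : ℂ} :
    z ∈ spectrum ℂ (F.map (algebraMap ℝ ℂ)) ↔
      ∃ u v : Fin n → ℝ, (u ≠ 0 ∨ v ≠ 0) ∧ F *ᵥ u = z.re • u - z.im • v ∧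
        F *ᵥ v = z.im • u + z.re • v := by
  rw [spectrum.mem_iff, Matrix.isUnit_iff_isUnit_det, isUnit_iff_ne_zero, not_not,
    ← Matrix.exists_mulVec_eq_zero_iff]
  have key : ∀ x : Fin n → ℂ, (algebraMap ℂ (Matrix (Fin n) (Fin n) ℂ) z -
      F.map (algebraMap ℝ ℂ)) *ᵥ x = 0 ↔
      (F *ᵥ fun i => (x i).re) = (z.re • fun i => (x i).re) - z.im • (fun i => (x i).im) ∧
      (F *ᵥ fun i => (x i).im) = (z.im • fun i => (x i).re) + z.re • (fun i => (x i).im) := by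
    intro x
    rw [Matrix.sub_mulVec, sub_eq_zero, Algebra.algebraMap_eq_smul_one, Matrix.smul_mulVec,
      Matrix.one_mulVec, funext_iff, funext_iff, funext_iff, ← forall_and]
    refine forall_congr' fun i => ?_
    rw [Complex.ext_iff]
    simp only [Matrix.mulVec, dotProduct, Matrix.map_apply, Pi.smul_apply, Pi.add_apply,
      Pi.sub_apply, smul_eq_mul, Complex.re_sum, Complex.im_sum, Complex.mul_re, Complex.mul_im,
      Complex.coe_algebraMap, Complex.ofReal_re, Complex.ofReal_im, zero_mul, sub_zero, add_zero]
    constructor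
    · rintro ⟨h1, h2⟩
      exact ⟨h1.symm, by rw [← h2]; ring⟩
    · rintro ⟨h1, h2⟩
      exact ⟨h1.symm, by rw [h2]; ring⟩
  constructor
  · rintro ⟨x, hx, h⟩
    refine ⟨_, _, ?_, (key x).1 h⟩
    by_contra! h0
    exact hx (funext fun i => Complex.ext (congrFun h0.1 i) (congrFun h0.2 i))
  · rintro ⟨u, v, huv, h⟩
    refine ⟨fun i => ⟨u i, v i⟩, fun h0 => ?_, (key _).2 h⟩
    have h1 := fun i => Complex.ext_iff.1 (congrFun h0 i)
    rcases huv with hu | hv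
    · exact hu (funext fun i => (h1 i).1)
    · exact hv (funext fun i => (h1 i).2)

variable {A : Matrix (Fin n) (Fin n) ℝ} {B : Matrix (Fin n) (Fin b) ℝ}
  {C : Matrix (Fin c) (Fin n) ℝ} {P : Matrix (Fin n) (Fin n) ℝ}

/-- For an eigenvector w with eigenvalue z, 2 Re(z) w*Pw = -|BᵀPw|² - |Cw|². If Re z ≥ 0, both BᵀPw
and Cw vanish, so w is an eigenvector of A - LC for the same z, against detectability. -/
theorem IsPSDSolutionARE.isStableMatrix (hP : IsPSDSolutionARE A B C P)
    (hAC : IsDetectable A C) : IsStableMatrix (A - B * Bᵀ * P) := by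
  obtain ⟨L, hL⟩ := hAC
  intro z hz
  by_contra! hre
  obtain ⟨u, v, huv, hu, hv⟩ := mem_spectrum_map_iff.1 hz
  have hPt : Pᵀ = P := by simpa using hP.1.isHermitian.eq
  have hform : ∀ x : Fin n → ℝ, 2 * (((A - B * Bᵀ * P) *ᵥ x) ⬝ᵥ (P *ᵥ x)) =
      -(((Bᵀ * P) *ᵥ x) ⬝ᵥ ((Bᵀ * P) *ᵥ x) + (C *ᵥ x) ⬝ᵥ (C *ᵥ x)) := by
    intro x
    have h1 : ((A - B * Bᵀ * P) *ᵥ x) ⬝ᵥ (P *ᵥ x) =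
        x ⬝ᵥ (((A - B * Bᵀ * P)ᵀ * P) *ᵥ x) := by
      rw [← Matrix.mulVec_mulVec, Matrix.dotProduct_mulVec x, Matrix.vecMul_transpose]
    have h2 : ((A - B * Bᵀ * P) *ᵥ x) ⬝ᵥ (P *ᵥ x) =
        x ⬝ᵥ ((P * (A - B * Bᵀ * P)) *ᵥ x) := by
      rw [← Matrix.mulVec_mulVec, Matrix.dotProduct_mulVec x, ← Matrix.mulVec_transpose, hPt,
        dotProduct_comm]
    have h3 : ∀ {k : ℕ} (N : Matrix (Fin k) (Fin n) ℝ),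
        (N *ᵥ x) ⬝ᵥ (N *ᵥ x) = x ⬝ᵥ ((Nᵀ * N) *ᵥ x) := fun N => by
      rw [← Matrix.mulVec_mulVec, Matrix.dotProduct_mulVec x, Matrix.vecMul_transpose]
    have h4 : (A - B * Bᵀ * P)ᵀ * P + P * (A - B * Bᵀ * P) =
        -((Bᵀ * P)ᵀ * (Bᵀ * P) + Cᵀ * C) := by
      rw [← sub_eq_zero, ← hP.2]
      simp only [riccati, Matrix.transpose_sub, Matrix.transpose_mul, Matrix.transpose_transpose,
        hPt, Matrix.mul_sub, Matrix.sub_mul, Matrix.mul_assoc]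
      abel
    have h5 := congrArg (fun N => x ⬝ᵥ (N *ᵥ x)) h4
    simp only [Matrix.add_mulVec, Matrix.neg_mulVec, dotProduct_add, dotProduct_neg] at h5
    rw [h3, h3]
    linarith
  have hu' := hform u
  have hv' := hform v
  have hsymm : u ⬝ᵥ (P *ᵥ v) = v ⬝ᵥ (P *ᵥ u) := by
    rw [Matrix.dotProduct_mulVec, ← Matrix.mulVec_transpose, hPt, dotProduct_comm]
  rw [hu, sub_dotProduct, smul_dotProduct, smul_dotProduct, smul_eq_mul, smul_eq_mul] at hu'
  rw [hv, add_dotProduct, smul_dotProduct, smul_dotProduct, smul_eq_mul, smul_eq_mul, hsymm] at hv'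
  have hPu : 0 ≤ u ⬝ᵥ (P *ᵥ u) := by simpa using hP.1.dotProduct_mulVec_nonneg u
  have hPv : 0 ≤ v ⬝ᵥ (P *ᵥ v) := by simpa using hP.1.dotProduct_mulVec_nonneg v
  have hself : ∀ {k : ℕ} (x : Fin k → ℝ), 0 ≤ x ⬝ᵥ x := fun x =>
    Finset.sum_nonneg fun i _ => mul_self_nonneg _
  -- When `hu'` and `hv'` are added, the cross terms with Im z cancel by symmetry of `P`.
  have hsum := add_nonneg (mul_nonneg hre hPu) (mul_nonneg hre hPv)
  have h1 := hself ((Bᵀ * P) *ᵥ u)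
  have h2 := hself ((Bᵀ * P) *ᵥ v)
  have h3 := hself (C *ᵥ u)
  have h4 := hself (C *ᵥ v)
  have hvanish : ∀ x : Fin n → ℝ, ((Bᵀ * P) *ᵥ x) ⬝ᵥ ((Bᵀ * P) *ᵥ x) = 0 →
      (C *ᵥ x) ⬝ᵥ (C *ᵥ x) = 0 → (A - L * C) *ᵥ x = (A - B * Bᵀ * P) *ᵥ x := by
    intro x hB hC
    rw [dotProduct_self_eq_zero] at hB hC
    rw [Matrix.sub_mulVec, Matrix.sub_mulVec, Matrix.mul_assoc, ← Matrix.mulVec_mulVec,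
      ← Matrix.mulVec_mulVec, hB, hC, Matrix.mulVec_zero, Matrix.mulVec_zero]
  refine (hL z (mem_spectrum_map_iff.2 ⟨u, v, huv, ?_, ?_⟩)).not_ge hre
  · rw [hvanish u (by linarith) (by linarith), hu]
  · rw [hvanish v (by linarith) (by linarith), hv]

/-- With Fᵢ = A - BBᵀPᵢ, R(P₁) - R(P₂) = F₁ᵀ(P₁ - P₂) + (P₁ - P₂)F₂. -/
theorem IsPSDSolutionARE.eq (hAC : IsDetectable A C) {P₁ P₂ : Matrix (Fin n) (Fin n) ℝ}
    (h₁ : IsPSDSolutionARE A B C P₁) (h₂ : IsPSDSolutionARE A B C P₂) : P₁ = P₂ := by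
  have hPt : P₁ᵀ = P₁ := by simpa using h₁.1.isHermitian.eq
  refine sub_eq_zero.1 ((h₁.isStableMatrix hAC).sylvester_eq_zero (h₂.isStableMatrix hAC) ?_)
  rw [← sub_self (0 : Matrix (Fin n) (Fin n) ℝ)]
  nth_rewrite 1 [← h₁.2]
  rw [← h₂.2]
  simp only [riccati, Matrix.transpose_sub, Matrix.transpose_mul, Matrix.transpose_transpose,
    hPt, Matrix.mul_sub, Matrix.sub_mul, Matrix.mul_assoc]
  abel

/-- `P` is the cost matrix of the feedback `K`, with source CᵀC + KᵀK; completing the square gives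
-R(P) = (K - BᵀP)ᵀ(K - BᵀP). -/
theorem IsStabilizable.exists_supersolution (hAB : IsStabilizable A B)
    (C : Matrix (Fin c) (Fin n) ℝ) :
    ∃ P : Matrix (Fin n) (Fin n) ℝ, P.PosSemidef ∧ (-riccati A B C P).PosSemidef := by
  obtain ⟨K, hK⟩ := hAB
  obtain ⟨P, hP, hPK⟩ := hK.exists_lyapunov
    ((posSemidef_transpose_mul_self_real C).add (posSemidef_transpose_mul_self_real K))
  have hPt : Pᵀ = P := by simpa using hP.isHermitian.eq
  refine ⟨P, hP, ?_⟩
  have : -riccati A B C P = (K - Bᵀ * P)ᵀ * (K - Bᵀ * P) := by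
    have h0 : (A - B * K)ᵀ * P + P * (A - B * K) + (Cᵀ * C + Kᵀ * K) = 0 := by
      rw [hPK, neg_add_cancel]
    rw [← sub_eq_zero, ← neg_eq_zero, ← h0]
    simp only [riccati, Matrix.transpose_sub, Matrix.transpose_mul, Matrix.transpose_transpose,
      hPt, Matrix.mul_sub, Matrix.sub_mul, Matrix.mul_assoc]
    abel
  rw [this]
  exact posSemidef_transpose_mul_self_real _

theorem existsUnique_isPSDSolutionARE (hAB : IsStabilizable A B) (hAC : IsDetectable A C) :
    ∃! P : Matrix (Fin n) (Fin n) ℝ, IsPSDSolutionARE A B C P := by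
  obtain ⟨S, hS, hRS⟩ := hAB.exists_supersolution C
  obtain ⟨P, hP⟩ := exists_isPSDSolutionARE_of_supersolution hS hRS
  exact ⟨P, hP, fun P' hP' => hP'.eq hAC hP⟩

end AlgebraicRiccati

/-! ### Cauchy–Schwarz and Frobenius approximation in an orthonormal basis -/

section GalerkinProjection

variable {n : ℕ}

theorem Matrix.PosSemidef.sq_bilin_le {S : Matrix (Fin n) (Fin n) ℝ} (hS : S.PosSemidef)
    (x y : Fin n → ℝ) :
    (x ⬝ᵥ (S *ᵥ y)) ^ 2 ≤ (x ⬝ᵥ (S *ᵥ x)) * (y ⬝ᵥ (S *ᵥ y)) := by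
  have hSt : Sᵀ = S := by simpa using hS.isHermitian.eq
  have hsymm : y ⬝ᵥ (S *ᵥ x) = x ⬝ᵥ (S *ᵥ y) := by
    rw [Matrix.dotProduct_mulVec, ← Matrix.mulVec_transpose, hSt, dotProduct_comm]
  have h := fun t : ℝ => hS.dotProduct_mulVec_nonneg (t • x + y)
  simp only [star_trivial, Matrix.mulVec_add, Matrix.mulVec_smul, dotProduct_add, add_dotProduct,
    smul_dotProduct, dotProduct_smul, smul_eq_mul, hsymm] at h
  have := discrim_le_zero (a := x ⬝ᵥ (S *ᵥ x)) (b := 2 * (x ⬝ᵥ (S *ᵥ y)))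
    (c := y ⬝ᵥ (S *ᵥ y)) fun t => by linarith [h t]
  rw [discrim] at this
  linarith

theorem frobeniusNorm_eq_sqrt (M : Matrix (Fin n) (Fin n) ℝ) :
    frobeniusNorm M = √(∑ i, ∑ j, M i j ^ 2) := by
  rw [frobeniusNorm, Matrix.frobenius_norm_def, Real.sqrt_eq_rpow]
  simp

/-- The square matrix with the given columns. -/
def columnMatrix (q : Fin n → EuclideanSpace ℝ (Fin n)) : Matrix (Fin n) (Fin n) ℝ :=
  Matrix.of fun a i => q i a

variable {q : Fin n → EuclideanSpace ℝ (Fin n)} {k : ℕ} (hk : k ≤ n)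

theorem columnMatrix_transpose_mul_mul_apply (M : Matrix (Fin n) (Fin n) ℝ) (i j : Fin n) :
    ((columnMatrix q)ᵀ * M * columnMatrix q) i j = ⇑(q i) ⬝ᵥ (M *ᵥ ⇑(q j)) := by
  rw [Matrix.mul_assoc, Matrix.mul_apply]
  rfl

theorem Orthonormal.columnMatrix_transpose_mul (hq : Orthonormal ℝ q) :
    (columnMatrix q)ᵀ * columnMatrix q = 1 := by
  ext i j
  have := orthonormal_iff_ite.1 hq i j
  rw [PiLp.inner_apply] at this
  simpa [Matrix.mul_apply, Matrix.one_apply, columnMatrix, mul_comm] using this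

theorem Orthonormal.columnMatrix_mul_transpose (hq : Orthonormal ℝ q) :
    columnMatrix q * (columnMatrix q)ᵀ = 1 :=
  mul_eq_one_comm.1 hq.columnMatrix_transpose_mul

/-- Orthogonal invariance of the Frobenius norm, from cyclicity of the trace. -/
theorem Orthonormal.frobeniusNorm_eq (hq : Orthonormal ℝ q) (M : Matrix (Fin n) (Fin n) ℝ) :
    frobeniusNorm M = √(∑ i, ∑ j, ((columnMatrix q)ᵀ * M * columnMatrix q) i j ^ 2) := by
  have htr : ∀ N : Matrix (Fin n) (Fin n) ℝ, ∑ i, ∑ j, N i j ^ 2 = (Nᵀ * N).trace := by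
    intro N
    rw [Finset.sum_comm]
    simp [Matrix.trace, Matrix.mul_apply, sq]
  rw [frobeniusNorm_eq_sqrt, htr, htr]
  congr 1
  set W := columnMatrix q
  calc (Mᵀ * M).trace = ((W * Wᵀ) * (Mᵀ * (W * Wᵀ) * M)).trace := by
        rw [hq.columnMatrix_mul_transpose, Matrix.mul_one, Matrix.one_mul]
    _ = (Wᵀ * (Mᵀ * (W * Wᵀ) * M) * W).trace := by
        rw [Matrix.mul_assoc, Matrix.trace_mul_comm]
    _ = _ := by
        congr 1
        simp only [Matrix.transpose_mul, Matrix.transpose_transpose, Matrix.mul_assoc]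

/-- The coordinate matrix of the first `k` vectors of a basis of length `n`. -/
def leadingCoordinates {n k : ℕ} (hk : k ≤ n) : Matrix (Fin n) (Fin k) ℝ :=
  Matrix.of fun i l => if i = Fin.castLE hk l then 1 else 0

theorem leadingColumns_eq : leadingColumns q k hk = columnMatrix q * leadingCoordinates hk := by
  ext a l
  simp [leadingColumns, columnMatrix, leadingCoordinates, Matrix.mul_apply]

theorem leadingCoordinates_mul_transpose :
    leadingCoordinates hk * (leadingCoordinates hk)ᵀ =
      Matrix.diagonal fun i : Fin n => if (i : ℕ) < k then (1 : ℝ) else 0 := by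
  ext i j
  simp only [leadingCoordinates, Matrix.mul_apply, Matrix.of_apply, Matrix.transpose_apply,
    Matrix.diagonal_apply, mul_ite, mul_one, mul_zero]
  by_cases hi : (i : ℕ) < k
  · rw [Finset.sum_eq_single ⟨i, hi⟩]
    · simp [Fin.ext_iff, hi, eq_comm]
    · intro l _ hl
      have : i ≠ Fin.castLE hk l := fun h => hl (Fin.ext (by simp [h]))
      simp [this]
    · simp
  · have : ∀ l, i ≠ Fin.castLE hk l := fun l h => hi (by rw [h]; exact l.2)
    simp [this, hi]

theorem Orthonormal.transpose_mul_galerkinProj_mul_apply (hq : Orthonormal ℝ q)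
    (M : Matrix (Fin n) (Fin n) ℝ) (i j : Fin n) :
    ((columnMatrix q)ᵀ * galerkinProj (leadingColumns q k hk) M * columnMatrix q) i j =
      if (i : ℕ) < k ∧ (j : ℕ) < k then ((columnMatrix q)ᵀ * M * columnMatrix q) i j else 0 := by
  set W := columnMatrix q
  set E := leadingCoordinates hk with hE
  have h1 : Wᵀ * galerkinProj (leadingColumns q k hk) M * W =
      (Wᵀ * W) * (E * Eᵀ) * (Wᵀ * M * W) * (E * Eᵀ) * (Wᵀ * W) := by
    rw [leadingColumns_eq]
    simp only [galerkinProj, Matrix.transpose_mul, Matrix.mul_assoc, W, E]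
  rw [h1, hq.columnMatrix_transpose_mul, Matrix.one_mul, Matrix.mul_one, hE,
    leadingCoordinates_mul_transpose, Matrix.mul_diagonal, Matrix.diagonal_mul]
  by_cases hi : (i : ℕ) < k <;> by_cases hj : (j : ℕ) < k <;> simp [hi, hj]

/-- Since QᵀQ = 1, the projection fixes `Z`, so `Z` has only a leading block. -/
theorem Orthonormal.transpose_mul_mul_apply_of_mem_galerkinSpace (hq : Orthonormal ℝ q)
    {Z : Matrix (Fin n) (Fin n) ℝ} (hZ : Z ∈ galerkinSpace (leadingColumns q k hk)) {i j : Fin n}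
    (hij : ¬((i : ℕ) < k ∧ (j : ℕ) < k)) :
    ((columnMatrix q)ᵀ * Z * columnMatrix q) i j = 0 := by
  obtain ⟨Y, rfl⟩ := hZ
  have hproj : galerkinProj (leadingColumns q k hk)
      (leadingColumns q k hk * Y * (leadingColumns q k hk)ᵀ) =
      leadingColumns q k hk * Y * (leadingColumns q k hk)ᵀ := by
    have hQ : (leadingColumns q k hk)ᵀ * leadingColumns q k hk = 1 := by
      ext a d
      have := congrFun (congrFun hq.columnMatrix_transpose_mul (Fin.castLE hk a)) (Fin.castLE hk d)
      simpa [Matrix.mul_apply, Matrix.one_apply, columnMatrix, leadingColumns] using this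
    set Q := leadingColumns q k hk
    calc _ = Q * (Qᵀ * Q) * Y * (Qᵀ * Q) * Qᵀ := by
          simp only [galerkinProj, Matrix.mul_assoc]
      _ = _ := by rw [hQ, Matrix.mul_one, Matrix.mul_one]
  rw [← hproj, hq.transpose_mul_galerkinProj_mul_apply, if_neg hij]

theorem galerkinProj_mem_galerkinSpace {m : ℕ} (Q : Matrix (Fin n) (Fin m) ℝ)
    (M : Matrix (Fin n) (Fin n) ℝ) : galerkinProj Q M ∈ galerkinSpace Q :=
  ⟨Qᵀ * M * Q, by simp only [galerkinProj, Matrix.mul_assoc]⟩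

theorem Orthonormal.frobeniusNorm_sub_galerkinProj_le (hq : Orthonormal ℝ q)
    (M : Matrix (Fin n) (Fin n) ℝ) {Z : Matrix (Fin n) (Fin n) ℝ}
    (hZ : Z ∈ galerkinSpace (leadingColumns q k hk)) :
    frobeniusNorm (M - galerkinProj (leadingColumns q k hk) M) ≤ frobeniusNorm (M - Z) := by
  rw [hq.frobeniusNorm_eq, hq.frobeniusNorm_eq]
  refine Real.sqrt_le_sqrt (Finset.sum_le_sum fun i _ => Finset.sum_le_sum fun j _ => ?_)
  rw [Matrix.mul_sub, Matrix.mul_sub, Matrix.sub_mul, Matrix.sub_mul, Matrix.sub_apply,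
    Matrix.sub_apply, hq.transpose_mul_galerkinProj_mul_apply]
  split_ifs with hij
  · rw [sub_self, zero_pow two_ne_zero]
    exact sq_nonneg _
  · rw [hq.transpose_mul_mul_apply_of_mem_galerkinSpace hk hZ hij]

theorem Orthonormal.frobeniusNorm_sub_galerkinProj_le_sqrt (hq : Orthonormal ℝ q)
    {M : Matrix (Fin n) (Fin n) ℝ} {β : Fin n × Fin n → ℝ}
    (hβ : ∀ i j, (⇑(q i) ⬝ᵥ (M *ᵥ ⇑(q j))) ^ 2 ≤ β (i, j)) :
    frobeniusNorm (M - galerkinProj (leadingColumns q k hk) M) ≤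
      √(∑ p : Fin n × Fin n with k ≤ (p.1 : ℕ) ∨ k ≤ (p.2 : ℕ), β p) := by
  rw [hq.frobeniusNorm_eq, Finset.sum_filter, Fintype.sum_prod_type]
  refine Real.sqrt_le_sqrt (Finset.sum_le_sum fun i _ => Finset.sum_le_sum fun j _ => ?_)
  rw [Matrix.mul_sub, Matrix.sub_mul, Matrix.sub_apply, hq.transpose_mul_galerkinProj_mul_apply,
    columnMatrix_transpose_mul_mul_apply]
  by_cases hij : (i : ℕ) < k ∧ (j : ℕ) < k
  · have : ¬(k ≤ (i : ℕ) ∨ k ≤ (j : ℕ)) := by lia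
    rw [if_pos hij, if_neg this, sub_self, zero_pow two_ne_zero]
  · have : k ≤ (i : ℕ) ∨ k ≤ (j : ℕ) := by omega
    rw [if_neg hij, if_pos this, sub_zero]
    exact hβ i j

end GalerkinProjection
theorem mainTheorem1 {n b c : ℕ}
    (A : Matrix (Fin n) (Fin n) ℝ) (B : Matrix (Fin n) (Fin b) ℝ) (C : Matrix (Fin c) (Fin n) ℝ)
    (hAB : IsStabilizable A B) (hAC : IsDetectable A C) :
    -- the algebraic equation has a unique positive semidefinite solution
    (∃! Xinf : Matrix (Fin n) (Fin n) ℝ, IsPSDSolutionARE A B C Xinf) ∧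
    -- the differential equation with zero initial value has a unique solution on `[0, ∞)`
    (∃ X : ℝ → Matrix (Fin n) (Fin n) ℝ, IsSolutionDRE A B C 0 X ∧
      ∀ Y : ℝ → Matrix (Fin n) (Fin n) ℝ, IsSolutionDRE A B C 0 Y →
        Set.EqOn Y X (Set.Ici 0)) ∧
    -- the bounds for these solutions
    ∀ (Xinf : Matrix (Fin n) (Fin n) ℝ) (hXinf : IsPSDSolutionARE A B C Xinf)
      (q : Fin n → EuclideanSpace ℝ (Fin n)), Orthonormal ℝ q →
      (∀ i : Fin n, Xinf *ᵥ ⇑(q i) = eigenvalueDesc hXinf.1.isHermitian i • ⇑(q i)) →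
      ∀ X : ℝ → Matrix (Fin n) (Fin n) ℝ, IsSolutionDRE A B C 0 X →
      ∀ t : ℝ, 0 ≤ t →
        (∀ i j : Fin n, |⇑(q i) ⬝ᵥ (X t *ᵥ ⇑(q j))| ≤
          √(eigenvalueDesc hXinf.1.isHermitian i * eigenvalueDesc hXinf.1.isHermitian j)) ∧
        ∀ (k : ℕ) (hk : k ≤ n),
          galerkinProj (leadingColumns q k hk) (X t) ∈ galerkinSpace (leadingColumns q k hk) ∧
          (∀ Z ∈ galerkinSpace (leadingColumns q k hk),
            frobeniusNorm (X t - galerkinProj (leadingColumns q k hk) (X t)) ≤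
              frobeniusNorm (X t - Z)) ∧
          frobeniusNorm (X t - galerkinProj (leadingColumns q k hk) (X t)) ≤
            √(∑ p : Fin n × Fin n with k ≤ (p.1 : ℕ) ∨ k ≤ (p.2 : ℕ),
              eigenvalueDesc hXinf.1.isHermitian p.1 *
                eigenvalueDesc hXinf.1.isHermitian p.2) := by
  refine ⟨existsUnique_isPSDSolutionARE hAB hAC, exists_unique_isSolutionDRE A B C, ?_⟩
  intro P hP q hq hPq X hX t ht
  have hnorm : ∀ i, ⇑(q i) ⬝ᵥ ⇑(q i) = 1 := fun i => by
    have := congrFun (congrFun hq.columnMatrix_transpose_mul i) i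
    simpa [Matrix.mul_apply, columnMatrix, dotProduct] using this
  have hXnn : ∀ x, 0 ≤ x ⬝ᵥ (X t *ᵥ x) := fun x => by
    simpa using (hX.posSemidef ht).dotProduct_mulVec_nonneg x
  -- As R(P) = 0, `P` is itself a supersolution, so X(t) ≤ P.
  have hle : ∀ i, ⇑(q i) ⬝ᵥ (X t *ᵥ ⇑(q i)) ≤ eigenvalueDesc hP.1.isHermitian i := by
    intro i
    have h := (hX.le_of_supersolution hP.1 (by rw [hP.2, neg_zero]; exact .zero)
      ht).dotProduct_mulVec_nonneg ⇑(q i)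
    rwa [star_trivial, Matrix.sub_mulVec, dotProduct_sub, hPq i, dotProduct_smul, hnorm,
      smul_eq_mul, mul_one, sub_nonneg] at h
  have hsq : ∀ i j, (⇑(q i) ⬝ᵥ (X t *ᵥ ⇑(q j))) ^ 2 ≤
      eigenvalueDesc hP.1.isHermitian i * eigenvalueDesc hP.1.isHermitian j := fun i j =>
    ((hX.posSemidef ht).sq_bilin_le _ _).trans
      (mul_le_mul (hle i) (hle j) (hXnn _) ((hXnn _).trans (hle i)))
  exact ⟨fun i j => Real.abs_le_sqrt (hsq i j), fun k hk =>
    ⟨galerkinProj_mem_galerkinSpace _ _, fun Z hZ => hq.frobeniusNorm_sub_galerkinProj_le hk _ hZ,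
      hq.frobeniusNorm_sub_galerkinProj_le_sqrt hk
        (β := fun p => eigenvalueDesc hP.1.isHermitian p.1 * eigenvalueDesc hP.1.isHermitian p.2)
        hsq⟩⟩
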